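/- **Model.** A (deterministic) first-order algorithm on $\mathbb{R}^d$ with $M$ bits of memory and $T$ queries consists of maps $\mathrm{dec}_t:\{0,1\}^M\to\mathbb{R}^d$, $\mathrm{enc}_t:\{0,1\}^M\times\mathbb{R}\times\mathbb{R}^d\to\{0,1\}^M$ ($0\le t<T$) and $\mathrm{out}:\{0,1\}^M\to\mathbb{R}^d$. On a function $F$ it starts from the memory $\mu_0=0$; in round $t$ it queries $x_t=\mathrm{dec}_t(\mu_t)$, receives $F(x_t)$ and an arbitrary subgradient $g_t\in\partial F(x_t)$, and sets $\mu_{t+1}=\mathrm{enc}_t(\mu_t,F(x_t),g_t)$. It outputs $\hat x=\mathrm{out}(\mu_T)$. **The discretized center-of-mass method.** It is determined by $B>0$, the number $T$ of queries, and three discretizations: $x\mapsto q_g(x)\in\mathbb{R}^d$ with $b_g$ bits for subgradients, $x\mapsto q_o(x)\in\mathbb{R}^d$ with $b_o$ bits for the output, and a discretization of function values that encodes each value separately with $b_f$ bits and decodes the list of the $T$ codes to a list of $T$ reals. Its memory has $M=T(b_g+b_f)$ bits: slot $t$ holds the code of $g_t$ and the code of $F(c_t)$. In round $t$ it recomputes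 from the stored $\tilde g_k=q_g(g_k)$, $k<t$, the sets $$K_0=\{x:\|x\|\le B\},\qquad K_{k+1}=K_k\cap\{x:\langle \tilde g_k,x-c_k\rangle\le 0\},\qquad c_k=\frac{\int_{K_k}x\,dx}{\int_{K_k}dx},$$ queries $c_t$, and stores the codes of $g_t$ and $F(c_t)$. In the end it recomputes all the centers and the decoded function values $\tilde F_0,\dots,\tilde F_{T-1}$ from the memory, and returns $\hat x=q_o(c_i)$ for an index $i$ minimizing $\tilde F_i$. **Theorem.** There is a universal constant $C>0$ such that for all $d\ge 1$, $L,B>0$ and $0<\epsilon\le LB$ there are $T$ and discretizations as above (depending only on $d,L,B,\epsilon$) with the following properties. 1. (Accuracy) $\|q_g(x)-x\|\le \frac{\epsilon}{12B}$ if $\|x\|\le L$, and $\|q_o(x)-x\|\le\frac{\epsilon}{3L}$ if $\|x\|\le B$. Any $T$ real numbers that pairwise differ by at most $2LB$ are decoded from their codes with error at most $\epsilon/3$, up to an additive constant common to all of them. 2. (Queries) $T\le C\,d\log\frac{2LB}{\epsilon}$. 3. (Memory) $M+b_o=T(b_g+b_f)+b_o\le C\,d^2\log^2\frac{2LB}{\epsilon}$.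 4. (Suboptimality) For every convex $L$-Lipschitz $F:\mathbb{R}^d\to\mathbb{R}$ with a minimizer $x^*$ satisfying $\|x^*\|\le B$, and for all valid choices of the subgradients, the output of the discretized center-of-mass method satisfies $F(\hat x)-F(x^*)\le\epsilon$. In particular the method uses $O(d\log\frac{LB}{\epsilon})$ function and gradient queries and $O(d^2\log^2\frac{LB}{\epsilon})$ bits of memory for $\epsilon\le LB/2$. -/

import Mathlib

open MeasureTheory
open scoped NNReal RealInnerProductSpace

noncomputable section

namespace MemoryBounded

/-- The Euclidean space of dimension `d`. -/
abbrev E (d : ℕ) := EuclideanSpace ℝ (Fin d)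

/-- Strings of `b` bits. -/
abbrev Bits (b : ℕ) := Fin b → Bool

/-! ### Memory-bounded first-order algorithms -/

/-- A deterministic first-order algorithm on `ℝᵈ` with `M` bits of memory and `T` queries. In
round `t` the query point is a function of the memory alone, and the new memory is a function of the
old memory, the function value and the subgradient at the query point. The output is a function of
the final memory. The maps themselves are arbitrary. -/
structure Algorithm (d M T : ℕ) where
  dec : Fin T → Bits M → E d
  enc : Fin T → Bits M → ℝ → E d → Bits M
  out : Bits M → E d

namespace Algorithm

variable {d M T : ℕ}

/-- The memory after `t` rounds, when the function is `F` and the subgradient returned in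
round `t` is `g t`. The memory is blank at the start. -/
def memory (A : Algorithm d M T) (F : E d → ℝ) (g : Fin T → E d) : ℕ → Bits M
  | 0 => fun _ => false
  | t + 1 =>
      if h : t < T then
        A.enc ⟨t, h⟩ (A.memory F g t) (F (A.dec ⟨t, h⟩ (A.memory F g t))) (g ⟨t, h⟩)
      else A.memory F g t

/-- The point queried in round `t`. -/
def query (A : Algorithm d M T) (F : E d → ℝ) (g : Fin T → E d) (t : Fin T) : E d :=
  A.dec t (A.memory F g t)

/-- The output after all `T` rounds. -/
def output (A : Algorithm d M T) (F : E d → ℝ) (g : Fin T → E d) : E d :=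
  A.out (A.memory F g T)

end Algorithm

/-- `v` is a subgradient of `F` at `x`. -/
def IsSubgradient {d : ℕ} (F : E d → ℝ) (x v : E d) : Prop :=
  ∀ y, F x + ⟪v, y - x⟫ ≤ F y

/-- All the answers `g` are valid: `g t` is a subgradient of `F` at the point queried in round
`t`. -/
def ValidAnswers {d M T : ℕ} (A : Algorithm d M T) (F : E d → ℝ) (g : Fin T → E d) : Prop :=
  ∀ t, IsSubgradient F (A.query F g t) (g t)

/-! ### Discretization -/

/-- A discretization of vectors with `b` bits. -/
structure VectorQuantizer (d b : ℕ) where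
  encode : E d → Bits b
  decode : Bits b → E d

/-- The discretized vector. -/
def VectorQuantizer.round {d b : ℕ} (q : VectorQuantizer d b) (x : E d) : E d :=
  q.decode (q.encode x)

/-- `q` discretizes the ball of radius `R` with Euclidean error at most `δ`. -/
def VectorQuantizer.Accurate {d b : ℕ} (q : VectorQuantizer d b) (R δ : ℝ) : Prop :=
  ∀ x, ‖x‖ ≤ R → ‖q.round x - x‖ ≤ δ

/-- A discretization of `T` real numbers with `b` bits each. Every number is encoded separately,
without knowledge of the others; the list of all the codes is decoded to a list of reals. -/
structure ValueQuantizer (T b : ℕ) where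
  encode : ℝ → Bits b
  decode : (Fin T → Bits b) → Fin T → ℝ

/-- Any `T` reals that differ pairwise by at most `R` are recovered with error at most `δ`, up to
one additive constant common to all of them. (Finitely many codes cannot do this for reals of
arbitrary size without the constant, which is immaterial when the values are only compared.) -/
def ValueQuantizer.Accurate {T b : ℕ} (q : ValueQuantizer T b) (R δ : ℝ) : Prop :=
  ∀ v : Fin T → ℝ, (∀ i j, |v i - v j| ≤ R) →
    ∃ a : ℝ, ∀ i, |q.decode (fun k => q.encode (v k)) i - (v i - a)| ≤ δ

/-! ### The center of mass method -/

/-- The center of mass `(∫ x in K, x) / (∫ x in K, 1)` of `K`. -/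
def centerOfMass {d : ℕ} (K : Set (E d)) : E d :=
  ⨍ x in K, x ∂volume

/-- The sets of the center of mass method: the first one is the ball of radius `B`, and each one is
cut through its center of mass `c k` by `{x | ⟪g k, x - c k⟫ ≤ 0}`. -/
def region {d : ℕ} (B : ℝ) (g : ℕ → E d) : ℕ → Set (E d)
  | 0 => Metric.closedBall 0 B
  | k + 1 => region B g k ∩ {x | ⟪g k, x - centerOfMass (region B g k)⟫ ≤ 0}

/-- The centers of the method. -/
def center {d : ℕ} (B : ℝ) (g : ℕ → E d) (k : ℕ) : E d :=
  centerOfMass (region B g k)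

section Layout

/- The memory consists of `T` slots, slot `t` holding the `bg` bits of the discretized subgradient
and the `bf` bits of the discretized function value of round `t`. -/

variable {T bg bf : ℕ}

def readGrad (μ : Bits (T * (bg + bf))) (t : Fin T) : Bits bg :=
  fun i => μ (finProdFinEquiv (t, Fin.castAdd bf i))

def readVal (μ : Bits (T * (bg + bf))) (t : Fin T) : Bits bf :=
  fun i => μ (finProdFinEquiv (t, Fin.natAdd bg i))

def writeSlot (μ : Bits (T * (bg + bf))) (t : Fin T) (cg : Bits bg) (cf : Bits bf) :
    Bits (T * (bg + bf)) :=
  fun k =>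
    if (finProdFinEquiv.symm k).1 = t then Fin.append cg cf (finProdFinEquiv.symm k).2 else μ k

end Layout

variable {d T bg bf bo : ℕ}

/-- The discretized subgradients stored in the memory. -/
def storedGrad (qg : VectorQuantizer d bg) (μ : Bits (T * (bg + bf))) (k : ℕ) : E d :=
  if h : k < T then qg.decode (readGrad μ ⟨k, h⟩) else 0

open Classical in
/-- An index at which `v` is minimal among the `c`'s: the point `c i` for some minimizer `i` of `v`
(and `0` for an empty list). -/
def argminPoint (v : Fin T → ℝ) (c : Fin T → E d) : E d :=
  if h : ∃ i, ∀ j, v i ≤ v j then c h.choose else 0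

/-- The memory-bounded center of mass method started from the ball of radius `B`. In round `t` the
center `c t` is recomputed from the stored discretized subgradients and queried, and the discretized
answers are written to slot `t`. At the end all the centers are recomputed, and a discretization
of one whose discretized function value is smallest is returned. -/
def comAlgorithm (B : ℝ) (qg : VectorQuantizer d bg) (qf : ValueQuantizer T bf)
    (qo : VectorQuantizer d bo) : Algorithm d (T * (bg + bf)) T where
  dec t μ := center B (storedGrad qg μ) t
  enc t μ y v := writeSlot μ t (qg.encode v) (qf.encode y)
  out μ := qo.round
    (argminPoint (qf.decode (readVal μ)) (fun t : Fin T => center B (storedGrad qg μ) t))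

end MemoryBounded

end

/-! A cut through the center of mass of a convex body leaves at most 3/4 of its volume
(`measureReal_cut_le`). Any constant below 1 would do, so a short argument through log-concavity
replaces Grünbaum's sharp bound. The midpoint Prékopa–Leindler inequality makes the volume of `K ∩
{t ≤ Z}`, with `Z` an affine function, midpoint log-concave in `t`. If the half-space through the
centroid held less than a quarter, these volumes would decay geometrically, and the positive part of
`Z` would have a smaller integral than the negative part.

After `T` cuts the volume is below `θ ^ d` times that of the initial ball, so some point `y` of the
copy of that ball shrunk towards `xs` by the factor `θ` has been cut off, say in round `k`. The
subgradient inequality at `center k` bounds its value by `F y`, up to the gradient rounding error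
times the diameter `2 * B`, and `F y` is close to `F xs` by the Lipschitz bound
(`exists_center_le`). Rounded gradients define the cuts themselves, so the queries can be reproduced
exactly from memory and errors do not accumulate.

Volume packing gives nets of the balls with `O(d log)` bits per vector. Function values are stored
modulo a window, since only their differences matter. -/

open scoped ENNReal

namespace MemoryBounded

/-! ### Midpoint Prékopa–Leindler and Brunn–Minkowski inequalities. -/

section PrekopaLeindler

theorem mul_le_sq_of_add_le_two_mul {a b c : ℝ≥0∞} (h : a + b ≤ 2 * c) : a * b ≤ c ^ 2 := by
  rcases eq_or_ne c ⊤ with rfl | hc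
  · simp
  have hab : a + b ≠ ⊤ := ne_top_of_le_ne_top (ENNReal.mul_ne_top (by simp) hc) h
  have ha : a ≠ ⊤ := fun h' => hab (by simp [h'])
  have hb : b ≠ ⊤ := fun h' => hab (by simp [h'])
  lift a to ℝ≥0 using ha
  lift b to ℝ≥0 using hb
  lift c to ℝ≥0 using hc
  norm_cast at h ⊢
  rw [← NNReal.coe_le_coe] at h ⊢
  push_cast at h ⊢
  nlinarith [sq_nonneg ((a : ℝ) - b), a.coe_nonneg, b.coe_nonneg, c.coe_nonneg]

/-- The one-dimensional Brunn–Minkowski inequality for compact sets. -/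
theorem volume_add_le_two_mul_of_isCompact {A B C : Set ℝ} (hA : IsCompact A) (hB : IsCompact B)
    (hA' : A.Nonempty) (hB' : B.Nonempty)
    (h : ∀ x ∈ A, ∀ y ∈ B, (2⁻¹ : ℝ) * (x + y) ∈ C) :
    volume A + volume B ≤ 2 * volume C := by
  obtain ⟨a, haA, ha⟩ := hA.exists_isGreatest hA'
  obtain ⟨b, hbB, hb⟩ := hB.exists_isLeast hB'
  have h1 : volume ((fun x => x + -b) ⁻¹' A) = volume A := measure_preimage_add_right _ _ _
  have h2 : volume ((fun x => x + -a) ⁻¹' B) = volume B := measure_preimage_add_right _ _ _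
  have hm : MeasurableSet ((fun x => x + -a) ⁻¹' B) :=
    hB.measurableSet.preimage (by fun_prop)
  have h3 := measure_union_add_inter (μ := volume) ((fun x => x + -b) ⁻¹' A) hm
  have h4 : volume ((fun x => x + -b) ⁻¹' A ∩ (fun x => x + -a) ⁻¹' B) = 0 := by
    refine measure_mono_null (t := {a + b}) ?_ (by simp)
    rintro x ⟨hx1, hx2⟩
    have := ha hx1
    have := hb hx2
    simp only [Set.mem_singleton_iff]
    linarith
  have h5 : volume ((fun x : ℝ => 2⁻¹ * x) ⁻¹' C) = 2 * volume C := by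
    rw [Real.volume_preimage_mul_left (by norm_num)]
    norm_num
  -- The translates `A + min B` and `max A + B` both lie in `2 C` and meet at most in the point `max
  -- A + min B`.
  rw [← h1, ← h2, ← h3, h4, add_zero, ← h5]
  refine measure_mono ?_
  rintro x (hx | hx)
  · have := h _ hx _ hbB
    simpa using this
  · have := h _ haA _ hx
    simpa using this

/-- The one-dimensional Brunn–Minkowski inequality. -/
theorem volume_add_le_two_mul {A B C : Set ℝ} (hA : MeasurableSet A) (hB : MeasurableSet B)
    (hA' : A.Nonempty) (hB' : B.Nonempty)
    (h : ∀ x ∈ A, ∀ y ∈ B, (2⁻¹ : ℝ) * (x + y) ∈ C) :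
    volume A + volume B ≤ 2 * volume C := by
  obtain ⟨a, ha⟩ := hA'
  obtain ⟨b, hb⟩ := hB'
  have key : ∀ K₁, K₁ ⊆ A → IsCompact K₁ → ∀ K₂, K₂ ⊆ B → IsCompact K₂ →
      volume K₁ + volume K₂ ≤ 2 * volume C := by
    intro K₁ h₁ hK₁ K₂ h₂ hK₂
    -- Inserting `a` and `b` keeps the compact approximations nonempty, as the compact case
    -- requires.
    refine le_trans (add_le_add (measure_mono (Set.subset_insert a K₁))
      (measure_mono (Set.subset_insert b K₂))) <|
      volume_add_le_two_mul_of_isCompact (hK₁.insert a) (hK₂.insert b) ⟨a, by simp⟩ ⟨b, by simp⟩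
        fun x hx y hy => h x (Set.insert_subset ha h₁ hx) y (Set.insert_subset hb h₂ hy)
  rw [hA.measure_eq_iSup_isCompact, hB.measure_eq_iSup_isCompact]
  refine ENNReal.biSup_add_biSup_le' ⟨∅, by simp⟩ ⟨∅, by simp⟩ fun K₁ h₁ K₂ h₂ => ?_
  by_cases hK₁ : IsCompact K₁
  · by_cases hK₂ : IsCompact K₂
    · simpa [hK₁, hK₂] using key K₁ h₁ hK₁ K₂ h₂ hK₂
    · simpa [hK₁, hK₂] using key K₁ h₁ hK₁ ∅ (by simp) (by simp)
  · by_cases hK₂ : IsCompact K₂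
    · simpa [hK₁, hK₂] using key ∅ (by simp) (by simp) K₂ h₂ hK₂
    · simp [hK₁, hK₂]

/-- The Prékopa–Leindler inequality for midpoints, as a property of a measure. -/
def MidpointPrekopaLeindler {X : Type*} [AddCommGroup X] [Module ℝ X] [MeasurableSpace X]
    (μ : Measure X) : Prop :=
  ∀ f g h : X → ℝ≥0∞, Measurable f → Measurable g → Measurable h →
    (∀ x y, f x * g y ≤ h ((2⁻¹ : ℝ) • (x + y)) ^ 2) →
    (∫⁻ x, f x ∂μ) * (∫⁻ x, g x ∂μ) ≤ (∫⁻ x, h x ∂μ) ^ 2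

/-- Layer-cake formula plus one-dimensional Brunn–Minkowski on each superlevel set. Equal suprema
matter: the level sets of `f` and `g` are then nonempty for the same levels `t < 1`. -/
theorem lintegral_add_le_two_mul_of_iSup_eq_one {f g h : ℝ → ℝ≥0∞} (hf : Measurable f)
    (hg : Measurable g) (hh : Measurable h) (hf1 : ⨆ x, f x = 1) (hg1 : ⨆ x, g x = 1)
    (H : ∀ x y, f x * g y ≤ h ((2⁻¹ : ℝ) • (x + y)) ^ 2) :
    (∫⁻ x, f x) + (∫⁻ x, g x) ≤ 2 * ∫⁻ x, h x := by
  have layer : ∀ u : ℝ → ℝ≥0∞, Measurable u → (∀ x, u x ≤ 1) →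
      ∫⁻ x, u x = ∫⁻ t in Set.Ioi (0 : ℝ), volume {x | ENNReal.ofReal t < u x} := by
    intro u hu hu1
    have hfin : ∀ x, u x ≠ ⊤ := fun x => ne_top_of_le_ne_top (by simp) (hu1 x)
    have := lintegral_eq_lintegral_meas_lt (volume : Measure ℝ) (f := fun x => (u x).toReal)
      (Filter.Eventually.of_forall fun x => ENNReal.toReal_nonneg) hu.ennreal_toReal.aemeasurable
    simp only [ENNReal.ofReal_toReal (hfin _)] at this
    rw [this]
    refine setLIntegral_congr_fun measurableSet_Ioi fun t ht => ?_
    simp only [ENNReal.ofReal_lt_iff_lt_toReal (le_of_lt ht) (hfin _)]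
  have hfle : ∀ x, f x ≤ 1 := fun x => hf1 ▸ le_iSup f x
  have hgle : ∀ x, g x ≤ 1 := fun x => hg1 ▸ le_iSup g x
  -- Truncating `h` at 1 makes it finite for the layer-cake formula and loses nothing, as only
  -- levels below 1 contribute.
  have hmin : ∫⁻ x, min (h x) 1 ≤ ∫⁻ x, h x := lintegral_mono fun x => min_le_left _ _
  refine le_trans ?_ (mul_le_mul_right hmin 2)
  rw [layer f hf hfle, layer g hg hgle, layer (fun x => min (h x) 1) (by fun_prop) (by simp)]
  have mono : ∀ u : ℝ → ℝ≥0∞, Measurable fun t : ℝ => volume {x | ENNReal.ofReal t < u x} := by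
    intro u
    refine Antitone.measurable fun s t hst => measure_mono fun x hx => ?_
    exact lt_of_le_of_lt (ENNReal.ofReal_le_ofReal hst) hx
  rw [← lintegral_add_left (mono f), ← lintegral_const_mul _ (mono _)]
  refine setLIntegral_mono' measurableSet_Ioi fun t ht => ?_
  rcases lt_or_ge t 1 with h1 | h1
  · have ht1 : ENNReal.ofReal t < 1 := by simpa using h1
    refine volume_add_le_two_mul (measurableSet_lt measurable_const hf)
      (measurableSet_lt measurable_const hg) ?_ ?_ ?_
    · exact lt_iSup_iff.1 (hf1 ▸ ht1)
    · exact lt_iSup_iff.1 (hg1 ▸ ht1)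
    · intro x hx y hy
      refine lt_min ?_ ht1
      have h2 : ENNReal.ofReal t ^ 2 < h ((2⁻¹ : ℝ) • (x + y)) ^ 2 := by
        refine lt_of_lt_of_le ?_ (H x y)
        rw [sq]
        exact ENNReal.mul_lt_mul hx hy
      exact lt_of_not_ge fun hle => absurd (pow_le_pow_left' hle 2) (not_le.2 h2)
  · have hz : ∀ u : ℝ → ℝ≥0∞, (∀ x, u x ≤ 1) → {x | ENNReal.ofReal t < u x} = ∅ := by
      intro u hu
      ext x
      simp only [Set.mem_ofPred_eq, Set.mem_empty_iff_false, iff_false, not_lt]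
      exact (hu x).trans (by simpa using h1)
    rw [hz f hfle, hz g hgle]
    simp

theorem midpointPrekopaLeindler_real : MidpointPrekopaLeindler (volume : Measure ℝ) := by
  have bounded : ∀ f g h : ℝ → ℝ≥0∞, Measurable f → Measurable g → Measurable h →
      (⨆ x, f x ≠ ⊤) → (⨆ x, g x ≠ ⊤) →
      (∀ x y, f x * g y ≤ h ((2⁻¹ : ℝ) • (x + y)) ^ 2) →
      (∫⁻ x, f x) * (∫⁻ x, g x) ≤ (∫⁻ x, h x) ^ 2 := by
    intro f g h hf hg hh hfT hgT H
    rcases eq_or_ne (⨆ x, f x) 0 with hf0 | hf0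
    · simp [ENNReal.iSup_eq_zero.1 hf0]
    rcases eq_or_ne (⨆ x, g x) 0 with hg0 | hg0
    · simp [ENNReal.iSup_eq_zero.1 hg0]
    set a := ⨆ x, f x
    set b := ⨆ x, g x
    -- Normalizing both suprema to 1 rescales `h` by the geometric mean of the two factors; the
    -- additive inequality then gives the multiplicative one by AM-GM.
    set s : ℝ≥0∞ := (a⁻¹ * b⁻¹) ^ (2⁻¹ : ℝ)
    have hs : s ^ 2 = a⁻¹ * b⁻¹ := by
      rw [← ENNReal.rpow_natCast, ← ENNReal.rpow_mul]
      norm_num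
    have key := mul_le_sq_of_add_le_two_mul <|
      lintegral_add_le_two_mul_of_iSup_eq_one (f := fun x => a⁻¹ * f x) (g := fun x => b⁻¹ * g x)
      (h := fun x => s * h x) (by fun_prop) (by fun_prop) (by fun_prop)
      (by rw [← ENNReal.mul_iSup]; exact ENNReal.inv_mul_cancel hf0 hfT)
      (by rw [← ENNReal.mul_iSup]; exact ENNReal.inv_mul_cancel hg0 hgT)
      (fun x y => by
        rw [mul_pow, hs, mul_mul_mul_comm]
        gcongr
        exact H x y)
    rw [lintegral_const_mul _ hf, lintegral_const_mul _ hg, lintegral_const_mul _ hh, mul_pow, hs,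
      mul_mul_mul_comm] at key
    refine (ENNReal.mul_le_mul_iff_right (a := a⁻¹ * b⁻¹) ?_ ?_).1 key
    · simp [hfT, hgT]
    · exact ENNReal.mul_ne_top (by simpa) (by simpa)
  intro f g h hf hg hh H
  have trunc : ∀ u : ℝ → ℝ≥0∞, Measurable u →
      ∫⁻ x, u x = ⨆ n : ℕ, ∫⁻ x, min (u x) n := by
    intro u hu
    rw [← lintegral_iSup (f := fun (n : ℕ) x => min (u x) n) (fun n => by fun_prop)
      (fun m n hmn x => min_le_min le_rfl (Nat.cast_le.2 hmn))]
    congr 1 with x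
    rw [← inf_iSup_eq, ENNReal.iSup_natCast, inf_top_eq]
  rw [trunc f hf, trunc g hg, ENNReal.iSup_mul]
  refine iSup_le fun m => ?_
  rw [ENNReal.mul_iSup]
  refine iSup_le fun n => bounded _ _ h (by fun_prop) (by fun_prop) hh ?_ ?_ fun x y => ?_
  · exact ne_top_of_le_ne_top (ENNReal.natCast_ne_top m) (iSup_le fun x => min_le_right _ _)
  · exact ne_top_of_le_ne_top (ENNReal.natCast_ne_top n) (iSup_le fun x => min_le_right _ _)
  · exact (mul_le_mul' (min_le_left _ _) (min_le_left _ _)).trans (H x y)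

/-- Tonelli: the inequality on slices is exactly the hypothesis needed for the marginals. -/
theorem MidpointPrekopaLeindler.prod {X Y : Type*} [AddCommGroup X] [Module ℝ X]
    [MeasurableSpace X] [AddCommGroup Y] [Module ℝ Y] [MeasurableSpace Y] {μ : Measure X}
    {ν : Measure Y} [SFinite ν] (hμ : MidpointPrekopaLeindler μ)
    (hν : MidpointPrekopaLeindler ν) : MidpointPrekopaLeindler (μ.prod ν) := by
  intro f g h hf hg hh H
  rw [lintegral_prod _ hf.aemeasurable, lintegral_prod _ hg.aemeasurable,
    lintegral_prod _ hh.aemeasurable]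
  refine hμ _ _ _ hf.lintegral_prod_right' hg.lintegral_prod_right' hh.lintegral_prod_right'
    fun x x' => ?_
  exact hν _ _ _ (by fun_prop) (by fun_prop) (by fun_prop) fun y y' => H (x, y) (x', y')

theorem MidpointPrekopaLeindler.of_measurePreserving {X Y : Type*} [AddCommGroup X] [Module ℝ X]
    [MeasurableSpace X] [AddCommGroup Y] [Module ℝ Y] [MeasurableSpace Y] {μ : Measure X}
    {ν : Measure Y} (hμ : MidpointPrekopaLeindler μ) {e : X → Y} (he : MeasurePreserving e μ ν)
    (hmid : ∀ x y, e ((2⁻¹ : ℝ) • (x + y)) = (2⁻¹ : ℝ) • (e x + e y)) :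
    MidpointPrekopaLeindler ν := by
  intro f g h hf hg hh H
  rw [← he.lintegral_comp hf, ← he.lintegral_comp hg, ← he.lintegral_comp hh]
  have := he.measurable
  refine hμ _ _ _ (by fun_prop) (by fun_prop) (by fun_prop) fun x y => ?_
  rw [hmid]
  exact H _ _

theorem midpointPrekopaLeindler_pi (n : ℕ) :
    MidpointPrekopaLeindler (volume : Measure (Fin n → ℝ)) := by
  induction n with
  | zero =>
    intro f g h hf hg hh H
    rw [lintegral_unique, lintegral_unique, lintegral_unique]
    have hd : (volume : Measure (Fin 0 → ℝ)) Set.univ = 1 := by simp [volume_pi]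
    simp only [hd, mul_one]
    convert H default default using 4
  | succ n ih =>
    refine (midpointPrekopaLeindler_real.prod ih).of_measurePreserving
      (volume_preserving_piFinSuccAbove (fun _ : Fin (n + 1) => ℝ) 0).symm fun x y => ?_
    ext i
    refine Fin.cases ?_ (fun j => ?_) i <;>
      simp [MeasurableEquiv.piFinSuccAbove, mul_add]

theorem midpointPrekopaLeindler_euclideanSpace (n : ℕ) :
    MidpointPrekopaLeindler (volume : Measure (E n)) :=
  (midpointPrekopaLeindler_pi n).of_measurePreserving
    (PiLp.volume_preserving_toLp (Fin n)) fun _ _ => rfl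

/-- The multiplicative Brunn–Minkowski inequality for midpoints. -/
theorem volume_mul_volume_le_sq {n : ℕ} {A B C : Set (E n)} (hA : MeasurableSet A)
    (hB : MeasurableSet B) (hC : MeasurableSet C)
    (h : ∀ x ∈ A, ∀ y ∈ B, (2⁻¹ : ℝ) • (x + y) ∈ C) :
    volume A * volume B ≤ volume C ^ 2 := by
  have := midpointPrekopaLeindler_euclideanSpace n (A.indicator 1) (B.indicator 1)
    (C.indicator 1) (measurable_one.indicator hA) (measurable_one.indicator hB)
    (measurable_one.indicator hC) fun x y => by
      by_cases hx : x ∈ A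
      · by_cases hy : y ∈ B
        · have := h x hx y hy
          rw [Set.indicator_of_mem hx, Set.indicator_of_mem hy, Set.indicator_of_mem this]
          simp
        · simp [hy]
      · simp [hx]
  simpa [lintegral_indicator_one, hA, hB, hC] using this

end PrekopaLeindler

/-! ### A quarter of the volume on each side of the center of mass. -/

section Centroid

/-- Log-concavity makes successive ratios nonincreasing, so an initial ratio of at most 1/2
persists; monotonicity covers vanishing terms. -/
theorem le_half_pow_of_mul_le_sq {u : ℕ → ℝ} (h0 : ∀ k, 0 ≤ u k) (hanti : Antitone u)
    (hlc : ∀ k, u k * u (k + 2) ≤ u (k + 1) ^ 2) (h1 : 2 * u 1 ≤ u 0) (k : ℕ) :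
    u (k + 1) ≤ u 1 * (1 / 2) ^ k := by
  have step : ∀ k, 2 * u (k + 1) ≤ u k := by
    intro k
    induction k with
    | zero => exact h1
    | succ k ih =>
      rcases (h0 (k + 1)).eq_or_lt with hz | hpos
      · have := hanti (Nat.le_succ (k + 1))
        have := h0 (k + 1 + 1)
        simp only [Nat.succ_eq_add_one] at *
        linarith
      · have h3 := hlc k
        have h4 : 2 * u (k + 1) * u (k + 2) ≤ u (k + 1) ^ 2 :=
          (mul_le_mul_of_nonneg_right ih (h0 _)).trans h3
        refine le_of_mul_le_mul_left ?_ hpos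
        show u (k + 1) * (2 * u (k + 2)) ≤ _
        nlinarith
  induction k with
  | zero => simp
  | succ k ih =>
    have := step (k + 1)
    rw [pow_succ]
    linarith

/-- A staircase with steps of width `s` dominates the positive part. Integrated, it bounds a first
moment by a sum of tail volumes. -/
theorem max_zero_le_mul_sum_indicator {s : ℝ} (hs : 0 < s) (N : ℕ) {z : ℝ} (hz : z ≤ N * s) :
    max z 0 ≤ s * ∑ k ∈ Finset.range N, (Set.Ici ((k : ℝ) * s)).indicator 1 z := by
  induction N with
  | zero => simpa using hz
  | succ N ih =>
    rcases le_total ((N : ℝ) * s) z with h | h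
    · have : ∀ k ∈ Finset.range (N + 1),
          (Set.Ici ((k : ℝ) * s)).indicator (1 : ℝ → ℝ) z = 1 := by
        intro k hk
        refine Set.indicator_of_mem (Set.mem_Ici.2 (le_trans ?_ h)) _
        have : (k : ℝ) ≤ N := by exact_mod_cast Finset.mem_range_succ_iff.1 hk
        gcongr
      rw [Finset.sum_congr rfl this]
      push_cast at hz
      simp only [Finset.sum_const, Finset.card_range, nsmul_eq_mul, mul_one]
      push_cast
      exact max_le (by linarith) (by positivity)
    · refine (ih h).trans ?_
      rw [Finset.sum_range_succ]
      gcongr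
      exact le_add_of_nonneg_right (Set.indicator_nonneg (by simp) _)

variable {d : ℕ}

theorem setIntegral_inner_sub_centerOfMass {K : Set (E d)} (hK : IsCompact K) (v : E d) :
    ∫ x in K, ⟪v, x - centerOfMass K⟫ = 0 := by
  have hfin : volume K ≠ ⊤ := hK.measure_lt_top.ne
  have hi : IntegrableOn (fun x : E d => x) K := continuousOn_id.integrableOn_compact hK
  have hc : IntegrableOn (fun _ : E d => centerOfMass K) K := integrableOn_const hfin
  have : ∫ x in K, (x - centerOfMass K) = 0 := by
    rw [integral_sub hi hc, setIntegral_const, centerOfMass, measure_smul_setAverage _ hfin,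
      sub_self]
  rw [integral_inner (f := fun x => x - centerOfMass K) (hi.sub hc), this, inner_zero_right]

/-- By convexity, midpoints of points above levels `t₁` and `t₂` lie in `K` above the mean level;
Brunn–Minkowski applies. -/
theorem measureReal_halfSpace_mul_le_sq {K : Set (E d)} (hK : IsCompact K) (hconv : Convex ℝ K)
    (v c : E d) {t₁ t₂ t : ℝ} (ht : 2 * t = t₁ + t₂) :
    volume.real (K ∩ {x | t₁ ≤ ⟪v, x - c⟫}) * volume.real (K ∩ {x | t₂ ≤ ⟪v, x - c⟫}) ≤
      volume.real (K ∩ {x | t ≤ ⟪v, x - c⟫}) ^ 2 := by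
  have hm : ∀ r : ℝ, MeasurableSet (K ∩ {x | r ≤ ⟪v, x - c⟫}) := fun r =>
    hK.measurableSet.inter (measurableSet_le measurable_const (by fun_prop))
  have hfin : ∀ r : ℝ, volume (K ∩ {x | r ≤ ⟪v, x - c⟫}) ≠ ⊤ := fun r =>
    measure_ne_top_of_subset Set.inter_subset_left hK.measure_lt_top.ne
  have := volume_mul_volume_le_sq (hm t₁) (hm t₂) (hm t) ?_
  · simp only [Measure.real]
    rw [← ENNReal.toReal_mul, ← ENNReal.toReal_pow]
    exact ENNReal.toReal_mono (ENNReal.pow_ne_top (hfin t)) this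
  · rintro x ⟨hx, hx'⟩ y ⟨hy, hy'⟩
    refine ⟨?_, ?_⟩
    · rw [smul_add]
      exact hconv hx hy (by norm_num) (by norm_num) (by norm_num)
    · simp only [Set.mem_ofPred_eq, inner_sub_right, inner_smul_right, inner_add_right] at *
      linarith

/-- A half space whose boundary passes through the center of mass of a convex body contains at
least a quarter of the body. -/
theorem measureReal_le_four_mul_halfSpace {K : Set (E d)} (hK : IsCompact K)
    (hconv : Convex ℝ K) (v : E d) :
    volume.real K ≤ 4 * volume.real (K ∩ {x | 0 ≤ ⟪v, x - centerOfMass K⟫}) := by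
  set Z : E d → ℝ := fun x => ⟪v, x - centerOfMass K⟫ with hZ
  set V := volume.real K
  have hfin : volume K ≠ ⊤ := hK.measure_lt_top.ne
  have hZc : Continuous Z := by fun_prop
  set φ : ℝ → ℝ := fun t => volume.real (K ∩ {x | t ≤ Z x}) with hφ
  have hφ0 : ∀ t, 0 ≤ φ t := fun t => measureReal_nonneg
  have hφanti : Antitone φ := fun s t hst =>
    measureReal_mono (fun x hx => ⟨hx.1, hst.trans hx.2⟩)
      (measure_ne_top_of_subset Set.inter_subset_left hfin)
  have hφint : ∀ t, IntegrableOn (fun x => (Set.Ici t).indicator (1 : ℝ → ℝ) (Z x)) K ∧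
      ∫ x in K, (Set.Ici t).indicator (1 : ℝ → ℝ) (Z x) = φ t := by
    intro t
    have hm : MeasurableSet {x | t ≤ Z x} := measurableSet_le measurable_const hZc.measurable
    have : (fun x => (Set.Ici t).indicator (1 : ℝ → ℝ) (Z x)) =
        {x | t ≤ Z x}.indicator 1 := by
      ext x
      by_cases h : t ≤ Z x <;> simp [h]
    rw [this]
    refine ⟨(integrableOn_const (C := (1 : ℝ)) hfin).indicator hm, ?_⟩
    rw [integral_indicator_one hm, measureReal_restrict_apply hm, Set.inter_comm]
  have hpos : IntegrableOn (fun x => max (Z x) 0) K :=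
    (hZc.max continuous_const).continuousOn.integrableOn_compact hK
  have hneg : IntegrableOn (fun x => max (-Z x) 0) K :=
    (hZc.neg.max continuous_const).continuousOn.integrableOn_compact hK
  set a := ∫ x in K, max (Z x) 0 with ha
  have ha' : ∫ x in K, max (-Z x) 0 = a := by
    have h0 : ∫ x in K, Z x = 0 := setIntegral_inner_sub_centerOfMass hK v
    have h1 : ∫ x in K, (max (Z x) 0 - max (-Z x) 0) = ∫ x in K, Z x := by
      congr 1 with x
      rcases le_total (Z x) 0 with h | h
      · rw [max_eq_right h, max_eq_left (by linarith)]; ring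
      · rw [max_eq_left h, max_eq_right (by linarith)]; ring
    rw [integral_sub hpos hneg, h0] at h1
    linarith
  have ha0 : 0 ≤ a := integral_nonneg fun x => le_max_right _ _
  have hV0 : 0 ≤ V := measureReal_nonneg
  rcases hV0.eq_or_lt with hV | hV
  · rw [← hV]
    exact mul_nonneg (by norm_num) (hφ0 0)
  -- If the first moment vanishes, `Z` is nonnegative almost everywhere on `K` and the half-space
  -- carries all the volume.
  rcases ha0.eq_or_lt with hz | hapos
  · have h1 : (fun x => max (-Z x) 0) =ᵐ[volume.restrict K] 0 :=
      (integral_eq_zero_iff_of_nonneg (f := fun x => max (-Z x) 0)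
        (fun x => le_max_right _ _) hneg).1 (by rw [ha', ← hz])
    have h2 : V = φ 0 := by
      have h3 : V = ∫ x in K, (1 : ℝ) := by simp [V]
      rw [h3, ← (hφint 0).2]
      refine integral_congr_ae ?_
      filter_upwards [h1] with x hx
      simp only [Pi.zero_apply, max_eq_right_iff] at hx
      have hx' : 0 ≤ Z x := by linarith
      simp [hx']
    have := hφ0 0
    show V ≤ 4 * φ 0
    linarith
  -- With this `s`, Markov's inequality for the negative part gives `φ (-s) ≥ V / 2`. Under `φ 0 < V
  -- / 4` the ratio `φ 0 / φ (-s)` is then below 1/2.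
  set s := 2 * a / V with hs
  have hspos : 0 < s := by positivity
  have hsV : s * V = 2 * a := by rw [hs]; field_simp
  have markov : s * (V - φ (-s)) ≤ a := by
    rw [← ha', ← (hφint (-s)).2]
    have : V = ∫ x in K, (1 : ℝ) := by simp [V]
    have hone : IntegrableOn (fun _ : E d => (1 : ℝ)) K := integrableOn_const hfin
    rw [this, ← integral_sub hone (hφint _).1, ← integral_const_mul]
    refine integral_mono ((hone.sub (hφint _).1).const_mul s) hneg fun x => ?_
    by_cases h : -s ≤ Z x
    · simp [h]
    · simp only [Set.mem_Ici, h, not_false_eq_true, Set.indicator_of_notMem, sub_zero, mul_one]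
      exact le_max_of_le_left (by linarith)
  by_contra! hcon
  replace hcon : 4 * φ 0 < V := hcon
  have hφs : V ≤ 2 * φ (-s) := by nlinarith
  -- The index is shifted by one so that the sequence starts at level `-s`. The resulting bound `a ≤
  -- 2 * s * φ 0` is less than `s * V / 2 = a`.
  have hgeo := le_half_pow_of_mul_le_sq (u := fun k : ℕ => φ (((k : ℝ) - 1) * s))
    (fun k => hφ0 _)
    (fun i j hij => hφanti (by
      have : (i : ℝ) ≤ j := by exact_mod_cast hij
      gcongr))
    (fun k => measureReal_halfSpace_mul_le_sq hK hconv v _ (by push_cast; ring))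
    (by simp; linarith)
  simp only [Nat.cast_add, Nat.cast_one, add_sub_cancel_right, sub_self, zero_mul] at hgeo
  obtain ⟨R, hR⟩ := (hK.image hZc).bddAbove
  obtain ⟨N, hN⟩ := exists_nat_ge (R / s)
  have hNs : ∀ x ∈ K, Z x ≤ N * s := fun x hx =>
    (hR (Set.mem_image_of_mem Z hx)).trans ((div_le_iff₀ hspos).1 hN)
  have hub : a ≤ s * ∑ k ∈ Finset.range N, φ (k * s) := by
    have h1 : IntegrableOn (fun x => ∑ k ∈ Finset.range N,
        (Set.Ici ((k : ℝ) * s)).indicator (1 : ℝ → ℝ) (Z x)) K :=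
      integrable_finsetSum _ fun k _ => (hφint _).1
    calc a ≤ ∫ x in K, s * ∑ k ∈ Finset.range N,
          (Set.Ici ((k : ℝ) * s)).indicator (1 : ℝ → ℝ) (Z x) :=
        setIntegral_mono_on hpos (h1.const_mul s) hK.measurableSet fun x hx =>
          max_zero_le_mul_sum_indicator hspos N (hNs x hx)
      _ = _ := by
        rw [integral_const_mul, integral_finsetSum _ fun k _ => (hφint _).1]
        congr 1
        exact Finset.sum_congr rfl fun k _ => (hφint _).2
  have hsum : ∑ k ∈ Finset.range N, φ (k * s) ≤ φ 0 * 2 := by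
    calc _ ≤ ∑ k ∈ Finset.range N, φ 0 * (1 / 2 : ℝ) ^ k := Finset.sum_le_sum fun k _ => hgeo k
      _ = φ 0 * ∑ k ∈ Finset.range N, (1 / 2 : ℝ) ^ k := by rw [Finset.mul_sum]
      _ ≤ φ 0 * 2 := mul_le_mul_of_nonneg_left (sum_geometric_two_le N) (hφ0 0)
  have : a ≤ s * (φ 0 * 2) := hub.trans (by gcongr)
  nlinarith

theorem volume_hyperplane_eq_zero {v : E d} (hv : v ≠ 0) (c : E d) :
    volume {x : E d | ⟪v, x - c⟫ = 0} = 0 := by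
  have h1 : {x : E d | ⟪v, x - c⟫ = 0} = (fun x => x + -c) ⁻¹' ((ℝ ∙ v)ᗮ : Submodule ℝ (E d)) := by
    ext x
    simp [Submodule.mem_orthogonal_singleton_iff_inner_right, sub_eq_add_neg]
  rw [h1, measure_preimage_add_right]
  refine Measure.addHaar_submodule _ _ fun h => hv ?_
  have : v ∈ (ℝ ∙ v)ᗮ := h ▸ Submodule.mem_top
  simpa [Submodule.mem_orthogonal_singleton_iff_inner_right] using this

/-- A cut through the center of mass removes at least a quarter of a convex body. -/
theorem measureReal_cut_le {K : Set (E d)} (hK : IsCompact K) (hconv : Convex ℝ K) {v : E d}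
    (hv : v ≠ 0) :
    volume.real (K ∩ {x | ⟪v, x - centerOfMass K⟫ ≤ 0}) ≤ 3 / 4 * volume.real K := by
  have h1 := measureReal_le_four_mul_halfSpace hK hconv v
  have hfin : volume K ≠ ⊤ := hK.measure_lt_top.ne
  set c := centerOfMass K
  have hm : MeasurableSet (K ∩ {x | ⟪v, x - c⟫ ≤ 0}) :=
    hK.measurableSet.inter (measurableSet_le (by fun_prop) measurable_const)
  have h2 := measureReal_union_add_inter (μ := volume) (s := K ∩ {x | 0 ≤ ⟪v, x - c⟫}) hm
    (measure_ne_top_of_subset Set.inter_subset_left hfin)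
    (measure_ne_top_of_subset Set.inter_subset_left hfin)
  have h3 : volume.real ((K ∩ {x | 0 ≤ ⟪v, x - c⟫}) ∩ (K ∩ {x | ⟪v, x - c⟫ ≤ 0})) = 0 := by
    rw [Measure.real, measure_mono_null (fun x hx => le_antisymm hx.2.2 hx.1.2)
      (volume_hyperplane_eq_zero hv c)]
    rfl
  have h4 : volume.real ((K ∩ {x | 0 ≤ ⟪v, x - c⟫}) ∪ (K ∩ {x | ⟪v, x - c⟫ ≤ 0})) ≤
      volume.real K := measureReal_mono (by simp) hfin
  linarith

end Centroid

/-! ### Discretization by nets and by residues. -/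

section Quantizers

variable {d : ℕ}

/-- Packing: balls of radius `δ / 2` around the points are disjoint and fit in the ball of radius `R
+ δ / 2`. -/
theorem card_le_of_separated {R δ : ℝ} (hR : 0 ≤ R) (hδ : 0 < δ) (s : Finset (E d))
    (hs : ∀ x ∈ s, ‖x‖ ≤ R) (hsep : ∀ x ∈ s, ∀ y ∈ s, x ≠ y → δ ≤ ‖x - y‖) :
    (s.card : ℝ) ≤ (1 + 2 * R / δ) ^ d := by
  have hdisj : Set.PairwiseDisjoint (s : Set (E d)) fun c => Metric.ball c (δ / 2) := by
    rintro x hx y hy hxy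
    refine Metric.ball_disjoint_ball ?_
    rw [dist_eq_norm]
    linarith [hsep x hx y hy hxy]
  have hsub : (⋃ c ∈ s, Metric.ball c (δ / 2)) ⊆ Metric.ball (0 : E d) (R + δ / 2) := by
    refine Set.iUnion₂_subset fun x hx => Metric.ball_subset_ball' ?_
    rw [dist_zero_right]
    linarith [hs x hx]
  have hvol := measure_mono (μ := (volume : Measure (E d))) hsub
  rw [measure_biUnion_finset hdisj fun c _ => measurableSet_ball] at hvol
  simp only [Measure.addHaar_ball_of_pos _ _ (half_pos hδ),
    Measure.addHaar_ball_of_pos _ _ (show 0 < R + δ / 2 by positivity), Finset.sum_const,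
    nsmul_eq_mul, ← mul_assoc, finrank_euclideanSpace, Fintype.card_fin] at hvol
  have h1 := (ENNReal.mul_le_mul_iff_left (Metric.measure_ball_pos _ _ zero_lt_one).ne'
    measure_ball_lt_top.ne).1 hvol
  have h2 := ENNReal.toReal_le_of_le_ofReal (by positivity) h1
  rw [ENNReal.toReal_mul, ENNReal.toReal_ofReal (by positivity), ENNReal.toReal_natCast] at h2
  have h3 : (1 + 2 * R / δ) * (δ / 2) = R + δ / 2 := by field_simp; ring
  refine le_of_mul_le_mul_right ?_ (show 0 < (δ / 2) ^ d by positivity)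
  rwa [← mul_pow, h3]

/-- A separated set of maximal cardinality is a net: an uncovered point could be added to it. -/
theorem exists_finset_net {R δ : ℝ} (hR : 0 ≤ R) (hδ : 0 < δ) :
    ∃ s : Finset (E d), (s.card : ℝ) ≤ (1 + 2 * R / δ) ^ d ∧
      ∀ x, ‖x‖ ≤ R → ∃ y ∈ s, ‖y - x‖ ≤ δ := by
  classical
  let P : ℕ → Prop := fun n => ∃ s : Finset (E d), s.card = n ∧ (∀ x ∈ s, ‖x‖ ≤ R) ∧
    ∀ x ∈ s, ∀ y ∈ s, x ≠ y → δ ≤ ‖x - y‖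
  have hP : ∀ n, P n → n ≤ ⌊(1 + 2 * R / δ) ^ d⌋₊ := by
    rintro n ⟨s, rfl, hs, hsep⟩
    exact Nat.le_floor (card_le_of_separated hR hδ s hs hsep)
  have hP0 : P 0 := ⟨∅, by simp⟩
  obtain ⟨s, hcard, hs, hsep⟩ := Nat.findGreatest_spec (P := P) (Nat.zero_le _) hP0
  refine ⟨s, card_le_of_separated hR hδ s hs hsep, fun x hx => ?_⟩
  by_contra! hfar
  have hxs : x ∉ s := fun h => by
    have := hfar x h
    rw [sub_self, norm_zero] at this
    linarith
  have hP1 : P (s.card + 1) := by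
    refine ⟨insert x s, Finset.card_insert_of_notMem hxs, ?_, ?_⟩
    · intro y hy
      rcases Finset.mem_insert.1 hy with rfl | hy
      exacts [hx, hs y hy]
    · intro y hy z hz hyz
      rcases Finset.mem_insert.1 hy with rfl | hy' <;>
        rcases Finset.mem_insert.1 hz with rfl | hz'
      · exact absurd rfl hyz
      · rw [norm_sub_rev]; exact (hfar z hz').le
      · exact (hfar y hy').le
      · exact hsep y hy' z hz' hyz
  have := Nat.le_findGreatest (P := P) (m := s.card + 1) (hP _ hP1) hP1
  exact absurd (this.trans hcard.ge) (by simp)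

/-- The ball of radius `R` can be discretized with accuracy `δ` as soon as there are at least
`(1 + 2 R / δ) ^ d` codes. -/
theorem exists_vectorQuantizer {R δ : ℝ} (hR : 0 ≤ R) (hδ : 0 < δ) {b : ℕ}
    (hb : (1 + 2 * R / δ) ^ d ≤ 2 ^ b) : ∃ q : VectorQuantizer d b, q.Accurate R δ := by
  classical
  obtain ⟨s, hcard, hnet⟩ := exists_finset_net (d := d) hR hδ
  have hle : Fintype.card s ≤ Fintype.card (Bits b) := by
    have : (s.card : ℝ) ≤ (2 ^ b : ℕ) := by
      push_cast
      exact hcard.trans hb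
    simpa using (Nat.cast_le (α := ℝ)).1 this
  obtain ⟨e⟩ := Function.Embedding.nonempty_of_card_le hle
  obtain ⟨y, hy, -⟩ := hnet 0 (by simpa)
  have : Nonempty s := ⟨⟨y, hy⟩⟩
  refine ⟨⟨fun x => if h : ∃ y ∈ s, ‖y - x‖ ≤ δ then e ⟨h.choose, h.choose_spec.1⟩ else default,
    fun c => (Function.invFun e c : s)⟩, fun x hx => ?_⟩
  have h := hnet x hx
  simp only [VectorQuantizer.round, dif_pos h, Function.leftInverse_invFun e.injective _]
  exact h.choose_spec.2

/-- Reals in a window of length `R` can be discretized with accuracy `δ` as soon as there are more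
than `2 (R / δ + 1)` codes: store the integer part of `v / δ` modulo the number of codes. -/
theorem exists_valueQuantizer {R δ : ℝ} (hδ : 0 < δ) (T : ℕ) {b : ℕ}
    (hb : 2 * (R / δ + 1) < 2 ^ b) : ∃ q : ValueQuantizer T b, q.Accurate R δ := by
  have : NeZero (2 ^ b : ℕ) := ⟨by positivity⟩
  have e : ZMod (2 ^ b) ≃ Bits b := Fintype.equivOfCardEq (by simp [ZMod.card])
  refine ⟨⟨fun v => e (⌊v / δ⌋ : ℤ), fun c i =>
    δ * ((e.symm (c i) - e.symm (c ⟨0, i.pos⟩)).valMinAbs : ℝ)⟩, fun v hv => ?_⟩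
  rcases Nat.eq_zero_or_pos T with rfl | hT
  · exact ⟨0, fun i => i.elim0⟩
  let z : Fin T := ⟨0, hT⟩
  -- Decoding is relative to slot 0, so the common constant is the rounded value there. Differences
  -- of integer parts are below `R / δ + 1`, less than half the modulus, hence are recovered by
  -- `valMinAbs`.
  refine ⟨δ * ⌊v z / δ⌋, fun i => ?_⟩
  have hval : ((⌊v i / δ⌋ : ZMod (2 ^ b)) - (⌊v z / δ⌋ : ZMod (2 ^ b))).valMinAbs =
      ⌊v i / δ⌋ - ⌊v z / δ⌋ := by
    rw [ZMod.valMinAbs_spec]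
    refine ⟨by push_cast; rfl, ?_⟩
    have h1 : |v i / δ - v z / δ| ≤ R / δ := by
      rw [← sub_div, abs_div, abs_of_pos hδ]
      exact div_le_div_of_nonneg_right (hv i z) hδ.le
    have h2 := abs_le.1 h1
    have h3 := Int.floor_le (v i / δ)
    have h4 := Int.lt_floor_add_one (v i / δ)
    have h5 := Int.floor_le (v z / δ)
    have h6 := Int.lt_floor_add_one (v z / δ)
    constructor
    · rw [← Int.cast_lt (R := ℝ)]
      push_cast
      linarith
    · rw [← Int.cast_le (R := ℝ)]
      push_cast
      linarith
  have h3 := mul_le_mul_of_nonneg_left (Int.floor_le (v i / δ)) hδ.le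
  have h4 := mul_lt_mul_of_pos_left (Int.lt_floor_add_one (v i / δ)) hδ
  have h5 : δ * (v i / δ) = v i := by field_simp
  simp only [Equiv.symm_apply_apply]
  rw [show (⟨0, i.pos⟩ : Fin T) = z from rfl, hval, abs_le]
  push_cast
  constructor <;> linarith

/-- Here `b` is the base-2 logarithm rounded up: `1 / log 2 ≤ 2`, and the rounding costs at most `1
≤ 2 * y`. -/
theorem exists_bits {x y : ℝ} (hx : 1 ≤ x) (hxy : Real.log x ≤ y) (hy : 1 / 2 ≤ y) :
    ∃ b : ℕ, x ≤ 2 ^ b ∧ (b : ℝ) ≤ 4 * y := by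
  have h2 := Real.log_two_gt_d9
  have hlog : 0 ≤ Real.log x := Real.log_nonneg hx
  refine ⟨⌈Real.log x / Real.log 2⌉₊, ?_, ?_⟩
  · rw [← Real.log_le_log_iff (by linarith) (by positivity), Real.log_pow,
      ← div_le_iff₀ (by linarith)]
    exact Nat.le_ceil _
  · refine (Nat.ceil_lt_add_one (by positivity)).le.trans ?_
    have : Real.log x / Real.log 2 ≤ 2 * y := by
      rw [div_le_iff₀ (by linarith)]
      nlinarith
    linarith

end Quantizers

/-! ### Geometry of the localization sets. -/

section Region

variable {d : ℕ} {B : ℝ} {g : ℕ → E d}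

theorem region_congr {g' : ℕ → E d} {n : ℕ} (h : ∀ k < n, g k = g' k) :
    region B g n = region B g' n := by
  induction n with
  | zero => rfl
  | succ n ih =>
    rw [region, region, ih fun k hk => h k (by omega), h n (by omega)]

theorem center_congr {g' : ℕ → E d} {n : ℕ} (h : ∀ k < n, g k = g' k) :
    center B g n = center B g' n := by
  rw [center, center, region_congr h]

theorem isCompact_region (n : ℕ) : IsCompact (region B g n) := by
  induction n with
  | zero => exact isCompact_closedBall _ _
  | succ n ih => exact ih.inter_right (isClosed_le (by fun_prop) continuous_const)

theorem convex_region (n : ℕ) : Convex ℝ (region B g n) := by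
  induction n with
  | zero => exact convex_closedBall _ _
  | succ n ih =>
    refine ih.inter ?_
    simp only [inner_sub_right, sub_nonpos]
    exact convex_halfSpace_le (innerₛₗ ℝ (g n)).isLinear _

theorem region_subset_closedBall (n : ℕ) : region B g n ⊆ Metric.closedBall 0 B := by
  induction n with
  | zero => exact subset_rfl
  | succ n ih => exact Set.inter_subset_left.trans ih

theorem measureReal_region_pos (hB : 0 < B) (n : ℕ) : 0 < volume.real (region B g n) := by
  induction n with
  | zero =>
    exact ENNReal.toReal_pos (Metric.measure_closedBall_pos _ _ hB).ne'
      measure_closedBall_lt_top.ne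
  | succ n ih =>
    -- For `-g n` the half-space is the retained one, so each cut keeps at least a quarter, even
    -- when `g n = 0`.
    have h := measureReal_le_four_mul_halfSpace (isCompact_region (B := B) (g := g) n)
      (convex_region n) (-g n)
    simp only [inner_neg_left, Left.nonneg_neg_iff] at h
    show 0 < volume.real (region B g n ∩ _)
    linarith

theorem center_mem_region (hB : 0 < B) (n : ℕ) : center B g n ∈ region B g n := by
  have hK := isCompact_region (B := B) (g := g) n
  refine (convex_region n).set_average_mem hK.isClosed (fun h => ?_) hK.measure_lt_top.ne
    (ae_restrict_mem hK.measurableSet) (continuousOn_id.integrableOn_compact hK)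
  have := measureReal_region_pos (g := g) hB n
  rw [Measure.real, h] at this
  simp at this

theorem norm_center_le (hB : 0 < B) (n : ℕ) : ‖center B g n‖ ≤ B := by
  simpa using region_subset_closedBall n (center_mem_region (g := g) hB n)

theorem measureReal_region_le {n : ℕ} (h : ∀ k < n, g k ≠ 0) :
    volume.real (region B g n) ≤ (3 / 4) ^ n * volume.real (Metric.closedBall (0 : E d) B) := by
  induction n with
  | zero => simp [region]
  | succ n ih =>
    have h1 := measureReal_cut_le (isCompact_region (B := B) (g := g) n) (convex_region n)
      (h n (by omega))
    have h2 := ih fun k hk => h k (by omega)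
    rw [pow_succ]
    show volume.real (region B g n ∩ _) ≤ _
    linarith

theorem exists_inner_pos_of_notMem_region {n : ℕ} {y : E d} (hy : ‖y‖ ≤ B)
    (hn : y ∉ region B g n) : ∃ k < n, 0 < ⟪g k, y - center B g k⟫ := by
  induction n with
  | zero => exact absurd (by simpa [region] using hy) hn
  | succ n ih =>
    by_cases h : y ∈ region B g n
    · exact ⟨n, by omega, not_le.1 fun h' => hn ⟨h, h'⟩⟩
    · obtain ⟨k, hk, hk'⟩ := ih h
      exact ⟨k, by omega, hk'⟩

end Region

/-! ### Convergence with inexact subgradients. -/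

section Convergence

variable {d : ℕ}

/-- Testing at `x + v` gives `‖v‖ ^ 2 ≤ L * ‖v‖`. This places every answer in the ball where `qg` is
accurate. -/
theorem IsSubgradient.norm_le {F : E d → ℝ} {L : ℝ≥0} (hF : LipschitzWith L F) {x v : E d}
    (h : IsSubgradient F x v) : ‖v‖ ≤ L := by
  have h1 := h (x + v)
  rw [add_sub_cancel_left, real_inner_self_eq_norm_sq] at h1
  have h2 := (le_abs_self _).trans (hF.dist_le_mul (x + v) x)
  rw [dist_eq_norm, add_sub_cancel_left] at h2
  rcases (norm_nonneg v).eq_or_lt with h0 | h0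
  · rw [← h0]; exact L.coe_nonneg
  · nlinarith

theorem IsSubgradient.le_add_of_inner_nonneg {F : E d → ℝ} {x v v' y : E d} {η D : ℝ}
    (h : IsSubgradient F x v) (hv : ‖v' - v‖ ≤ η) (hD : ‖y - x‖ ≤ D)
    (hy : 0 ≤ ⟪v', y - x⟫) : F x ≤ F y + η * D := by
  have h1 := h y
  have h2 : ⟪v' - v, y - x⟫ ≤ η * D :=
    (real_inner_le_norm _ _).trans (mul_le_mul hv hD (norm_nonneg _) ((norm_nonneg _).trans hv))
  rw [inner_sub_left] at h2
  linarith

/-- The center of mass method with approximate subgradients. -/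
theorem exists_center_le {F : E d → ℝ} {L : ℝ≥0} {B η θ : ℝ} (hB : 0 < B) (hθ : 0 < θ)
    (hθ1 : θ ≤ 1) (hF : LipschitzWith L F) {xs : E d} (hxs : ‖xs‖ ≤ B) {T : ℕ}
    (hT : (3 / 4 : ℝ) ^ T < θ ^ d) {g v : ℕ → E d}
    (hv : ∀ k < T, IsSubgradient F (center B g k) (v k)) (hg : ∀ k < T, ‖g k - v k‖ ≤ η) :
    ∃ k < T, F (center B g k) ≤ F xs + L * (2 * θ * B) + η * (2 * B) := by
  have hdist : ∀ y : E d, ‖y‖ ≤ B → ∀ k, ‖y - center B g k‖ ≤ 2 * B := fun y hy k =>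
    (norm_sub_le _ _).trans (by linarith [norm_center_le (g := g) hB k])
  -- A zero rounded gradient cuts nothing, but its true subgradient has norm at most `η`, so that
  -- center is already good.
  by_cases hz : ∃ k < T, g k = 0
  · obtain ⟨k, hk, hk0⟩ := hz
    refine ⟨k, hk, ?_⟩
    have h1 := (hv k hk).le_add_of_inner_nonneg (hg k hk) (hdist xs hxs k) (by simp [hk0])
    have : 0 ≤ (L : ℝ) * (2 * θ * B) := by positivity
    linarith
  · push Not at hz
    have hvol := measureReal_region_le (B := B) hz
    -- This ball is the image of the initial ball under the contraction by `θ` towards `xs`.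
    have hball : ∀ y ∈ Metric.closedBall ((1 - θ) • xs) (θ * B),
        ‖y‖ ≤ B ∧ ‖y - xs‖ ≤ 2 * θ * B := by
      intro y hy
      rw [mem_closedBall_iff_norm] at hy
      constructor
      · calc ‖y‖ = ‖(y - (1 - θ) • xs) + (1 - θ) • xs‖ := by rw [sub_add_cancel]
          _ ≤ θ * B + (1 - θ) * B := by
            refine (norm_add_le _ _).trans (add_le_add hy ?_)
            rw [norm_smul, Real.norm_of_nonneg (by linarith)]
            exact mul_le_mul_of_nonneg_left hxs (by linarith)
          _ = B := by ring
      · calc ‖y - xs‖ = ‖(y - (1 - θ) • xs) - θ • xs‖ := by congr 1; module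
          _ ≤ θ * B + θ * B := by
            refine (norm_sub_le _ _).trans (add_le_add hy ?_)
            rw [norm_smul, Real.norm_of_nonneg hθ.le]
            exact mul_le_mul_of_nonneg_left hxs hθ.le
          _ = 2 * θ * B := by ring
    have hnot : ¬ Metric.closedBall ((1 - θ) • xs) (θ * B) ⊆ region B g T := by
      intro hsub
      have h1 := (measureReal_mono hsub (isCompact_region T).measure_lt_top.ne).trans hvol
      have h2 : volume.real (Metric.closedBall ((1 - θ) • xs) (θ * B)) =
          θ ^ d * volume.real (Metric.closedBall (0 : E d) B) := by
        simp only [Measure.real]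
        rw [Measure.addHaar_closedBall _ _ (by positivity), Measure.addHaar_closedBall _ _ hB.le,
          finrank_euclideanSpace, Fintype.card_fin, ENNReal.toReal_mul, ENNReal.toReal_mul,
          ENNReal.toReal_ofReal (by positivity), ENNReal.toReal_ofReal (by positivity), mul_pow,
          mul_assoc]
      rw [h2] at h1
      have h3 : 0 < volume.real (Metric.closedBall (0 : E d) B) :=
        measureReal_region_pos (g := g) hB 0
      exact absurd (le_of_mul_le_mul_right h1 h3) (not_le.2 hT)
    obtain ⟨y, hy, hyn⟩ := Set.not_subset.1 hnot
    obtain ⟨hyB, hyx⟩ := hball y hy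
    obtain ⟨k, hk, hk'⟩ := exists_inner_pos_of_notMem_region hyB hyn
    refine ⟨k, hk, ?_⟩
    have h1 := (hv k hk).le_add_of_inner_nonneg (hg k hk) (hdist y hyB k) hk'.le
    have h2 := (le_abs_self _).trans (hF.dist_le_mul y xs)
    rw [dist_eq_norm] at h2
    have h3 := mul_le_mul_of_nonneg_left hyx L.coe_nonneg
    linarith

end Convergence

/-! ### Correctness of the memory layout and error analysis. -/

section Memory

variable {d T bg bf bo : ℕ}

theorem readGrad_writeSlot (μ : Bits (T * (bg + bf))) (t s : Fin T) (cg : Bits bg)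
    (cf : Bits bf) :
    readGrad (writeSlot μ t cg cf) s = if s = t then cg else readGrad μ s := by
  ext i
  by_cases h : s = t <;> simp [readGrad, writeSlot, h]

theorem readVal_writeSlot (μ : Bits (T * (bg + bf))) (t s : Fin T) (cg : Bits bg)
    (cf : Bits bf) :
    readVal (writeSlot μ t cg cf) s = if s = t then cf else readVal μ s := by
  ext i
  by_cases h : s = t <;> simp [readVal, writeSlot, h]

variable (B : ℝ) (qg : VectorQuantizer d bg) (qf : ValueQuantizer T bf)
  (qo : VectorQuantizer d bo) (F : E d → ℝ) (g : Fin T → E d)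

/-- Round `t` writes slot `t` only, so a written slot is never overwritten. -/
theorem read_memory (t : ℕ) (k : Fin T) (hk : (k : ℕ) < t) :
    readGrad ((comAlgorithm B qg qf qo).memory F g t) k = qg.encode (g k) ∧
      readVal ((comAlgorithm B qg qf qo).memory F g t) k =
        qf.encode (F ((comAlgorithm B qg qf qo).query F g k)) := by
  induction t with
  | zero => omega
  | succ t ih =>
    rw [Algorithm.memory]
    split_ifs with ht
    · rw [comAlgorithm, readGrad_writeSlot, readVal_writeSlot, ← comAlgorithm]
      by_cases h : k = ⟨t, ht⟩
      · subst h
        simp [Algorithm.query]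
      · simp only [h, if_false]
        refine ih (lt_of_le_of_ne (Nat.lt_succ_iff.1 hk) fun h' => h (Fin.ext h'))
    · exact ih (by omega)

/-- The discretized subgradients, extended by zero. -/
def roundedGrad (k : ℕ) : E d :=
  if h : k < T then qg.round (g ⟨k, h⟩) else 0

theorem storedGrad_memory {t k : ℕ} (hk : k < t) :
    storedGrad qg ((comAlgorithm B qg qf qo).memory F g t) k = roundedGrad qg g k := by
  rw [storedGrad, roundedGrad]
  split_ifs with h
  · rw [(read_memory B qg qf qo F g t ⟨k, h⟩ hk).1, VectorQuantizer.round]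
  · rfl

/-- Slots not yet written decode to arbitrary vectors, which is harmless: the center of round `t`
depends only on indices below `t`. -/
theorem query_comAlgorithm (t : Fin T) :
    (comAlgorithm B qg qf qo).query F g t = center B (roundedGrad qg g) t :=
  center_congr fun _ hk => storedGrad_memory B qg qf qo F g hk

theorem output_comAlgorithm :
    (comAlgorithm B qg qf qo).output F g =
      qo.round (argminPoint
        (qf.decode fun t : Fin T => qf.encode (F (center B (roundedGrad qg g) t)))
        fun t : Fin T => center B (roundedGrad qg g) t) := by
  have h1 : (fun t : Fin T => center B
      (storedGrad qg ((comAlgorithm B qg qf qo).memory F g T)) t) =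
      fun t : Fin T => center B (roundedGrad qg g) t :=
    funext fun t => center_congr fun k hk =>
      storedGrad_memory B qg qf qo F g (hk.trans t.isLt)
  have h2 : readVal ((comAlgorithm B qg qf qo).memory F g T) =
      fun t : Fin T => qf.encode (F (center B (roundedGrad qg g) t)) :=
    funext fun t => by
      rw [(read_memory B qg qf qo F g T t t.isLt).2, query_comAlgorithm]
  rw [← h1, ← h2]
  rfl

theorem exists_argminPoint_eq (v : Fin T → ℝ) (c : Fin T → E d) (i₀ : Fin T) :
    ∃ i, argminPoint v c = c i ∧ ∀ j, v i ≤ v j := by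
  have : Nonempty (Fin T) := ⟨i₀⟩
  have h : ∃ i, ∀ j, v i ≤ v j := Finite.exists_min v
  exact ⟨h.choose, dif_pos h, h.choose_spec⟩

variable {B qg qf qo F g}

/-- The four terms come from the shrunken ball, the gradient rounding, the comparison of two rounded
values, and the output rounding. -/
theorem output_comAlgorithm_sub_le {L : ℝ≥0} {η δ κ θ : ℝ} (hB : 0 < B) (hθ : 0 < θ)
    (hθ1 : θ ≤ 1) (hT : (3 / 4 : ℝ) ^ T < θ ^ d) (hqg : qg.Accurate L η)
    (hqf : qf.Accurate (2 * L * B) δ) (hqo : qo.Accurate B κ) (hF : LipschitzWith L F)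
    {xs : E d} (hxs : ‖xs‖ ≤ B) (hg : ValidAnswers (comAlgorithm B qg qf qo) F g) :
    F ((comAlgorithm B qg qf qo).output F g) - F xs ≤
      L * (2 * θ * B) + η * (2 * B) + 2 * δ + L * κ := by
  set G := roundedGrad qg g with hG
  obtain ⟨k, hk, hkF⟩ := exists_center_le (g := G) (η := η)
    (v := fun k => if h : k < T then g ⟨k, h⟩ else 0) hB hθ hθ1 hF hxs hT
    (fun k hk => by
      simp only [hk, dif_pos]
      have := hg ⟨k, hk⟩
      rwa [query_comAlgorithm] at this)
    (fun k hk => by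
      simp only [hG, roundedGrad, hk, dif_pos]
      exact hqg _ ((hg ⟨k, hk⟩).norm_le hF))
  have hc : ∀ i : ℕ, ‖center B G i‖ ≤ B := norm_center_le hB
  obtain ⟨a, ha⟩ := hqf (fun i : Fin T => F (center B G i)) fun i j => by
    refine (hF.dist_le_mul _ _).trans ?_
    rw [dist_eq_norm, mul_comm (2 : ℝ), mul_assoc]
    gcongr
    exact (norm_sub_le _ _).trans (by linarith [hc i, hc j])
  obtain ⟨i, hi, hmin⟩ := exists_argminPoint_eq
    (qf.decode fun t : Fin T => qf.encode (F (center B G t)))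
    (fun t : Fin T => center B G t) ⟨k, hk⟩
  rw [output_comAlgorithm, hi]
  -- The unknown constant `a` occurs in both estimates and cancels.
  have h1 := (abs_le.1 (ha i)).1
  have h2 := (abs_le.1 (ha ⟨k, hk⟩)).2
  have h3 := hmin ⟨k, hk⟩
  have h4 := (le_abs_self _).trans (hF.dist_le_mul (qo.round (center B G i)) (center B G i))
  rw [dist_eq_norm] at h4
  have h5 := mul_le_mul_of_nonneg_left (hqo _ (hc i)) L.coe_nonneg
  simp only at h1 h2
  linarith

end Memory

/-! ### Choice of parameters. -/

theorem VectorQuantizer.Accurate.mono {d b : ℕ} {q : VectorQuantizer d b} {R δ δ' : ℝ}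
    (h : q.Accurate R δ) (hδ : δ ≤ δ') : q.Accurate R δ' :=
  fun x hx => (h x hx).trans hδ

theorem ValueQuantizer.Accurate.mono {T b : ℕ} {q : ValueQuantizer T b} {R δ δ' : ℝ}
    (h : q.Accurate R δ) (hδ : δ ≤ δ') : q.Accurate R δ' := fun v hv => by
  obtain ⟨a, ha⟩ := h v hv
  exact ⟨a, fun i => (ha i).trans hδ⟩

theorem exists_numQueries {d : ℕ} (hd : 1 ≤ d) {u ℓ : ℝ} (hu : 1 ≤ u)
    (hℓ : ℓ = Real.log (2 * u)) (hℓ' : 1 / 2 ≤ ℓ) :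
    ∃ T : ℕ, (3 / 4 : ℝ) ^ T < (1 / (8 * u)) ^ d ∧ (T : ℝ) ≤ 14 * (d * ℓ) := by
  have hd1 : (1 : ℝ) ≤ d := by exact_mod_cast hd
  -- `12 = 4 * 3`: each cut gains at least 1/4 in the logarithm, and `log (8 * u) ≤ 3 * ℓ`. The
  -- extra 1 is at most `2 * (d * ℓ)`.
  refine ⟨⌊12 * (d * ℓ)⌋₊ + 1, ?_, ?_⟩
  · rw [← Real.log_lt_log_iff (by positivity) (by positivity), Real.log_pow, Real.log_pow,
      one_div, Real.log_inv]
    have h1 : Real.log (3 / 4) ≤ -(1 / 4) := by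
      have := Real.log_le_sub_one_of_pos (show (0 : ℝ) < 3 / 4 by norm_num)
      linarith
    have h2 : Real.log (8 * u) ≤ 3 * ℓ := by
      have h3 : Real.log (8 * u) ≤ Real.log ((2 * u) ^ 3) := by
        refine Real.log_le_log (by positivity) ?_
        have : u ≤ u ^ 3 := le_self_pow₀ hu (by norm_num)
        nlinarith
      rw [Real.log_pow, ← hℓ] at h3
      exact_mod_cast h3
    have h4 := Nat.lt_floor_add_one (12 * (d * ℓ))
    push_cast
    nlinarith
  · push_cast
    have := Nat.floor_le (show 0 ≤ 12 * (d * ℓ) by positivity)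
    nlinarith

end MemoryBounded

open MemoryBounded in
theorem mainTheorem1 :
    ∃ C : ℝ, 0 < C ∧
      ∀ (d : ℕ) (L : ℝ≥0) (B ε : ℝ), 1 ≤ d → 0 < L → 0 < B → 0 < ε → ε ≤ L * B →
        ∃ (T bg bf bo : ℕ) (qg : VectorQuantizer d bg) (qf : ValueQuantizer T bf)
          (qo : VectorQuantizer d bo),
          -- the maps `qg`, `qf`, `qo` are discretizations of the required accuracy
          qg.Accurate L (ε / (12 * B)) ∧ qf.Accurate (2 * L * B) (ε / 3) ∧
          qo.Accurate B (ε / (3 * L)) ∧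
          -- number of queries
          (T : ℝ) ≤ C * d * Real.log (2 * L * B / ε) ∧
          -- number of bits, those of the discretized output included
          ((T * (bg + bf) + bo : ℕ) : ℝ) ≤ C * d ^ 2 * Real.log (2 * L * B / ε) ^ 2 ∧
          -- the output is `ε`-suboptimal
          ∀ (F : E d → ℝ) (xs : E d) (g : Fin T → E d),
            ConvexOn ℝ Set.univ F → LipschitzWith L F → (∀ x, F xs ≤ F x) → ‖xs‖ ≤ B →
            ValidAnswers (comAlgorithm B qg qf qo) F g →
            F ((comAlgorithm B qg qf qo).output F g) - F xs ≤ ε := by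
  refine ⟨1000, by norm_num, fun d L B ε hd hL hB hε hεLB => ?_⟩
  have hL' : (0 : ℝ) < L := hL
  have hd1 : (1 : ℝ) ≤ d := by exact_mod_cast hd
  obtain ⟨u, hu⟩ : ∃ u : ℝ, u = L * B / ε := ⟨_, rfl⟩
  have hu1 : 1 ≤ u := by rw [hu, le_div_iff₀ hε]; linarith
  have hlogu : Real.log (2 * L * B / ε) = Real.log (2 * u) := by rw [hu]; congr 1; ring
  rw [hlogu]
  obtain ⟨ℓ, hℓ⟩ : ∃ ℓ, ℓ = Real.log (2 * u) := ⟨_, rfl⟩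
  rw [← hℓ]
  have hℓ2 : 1 / 2 ≤ ℓ := by
    have h1 := Real.log_two_gt_d9
    have h2 : Real.log 2 ≤ Real.log (2 * u) := Real.log_le_log (by norm_num) (by linarith)
    linarith
  have hdℓ : ℓ ≤ d * ℓ := le_mul_of_one_le_left (by linarith) hd1
  have hpow : ∀ n : ℕ, Real.log ((2 * u) ^ n) = n * ℓ := fun n => by rw [Real.log_pow, hℓ]
  have hu5 : u ≤ u ^ 5 := le_self_pow₀ hu1 (by norm_num)
  have hu6 : u ≤ u ^ 6 := le_self_pow₀ hu1 (by norm_num)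
  obtain ⟨T, hT, hTle⟩ := exists_numQueries hd hu1 hℓ hℓ2
  obtain ⟨bv, hbv, hbvle⟩ := exists_bits (x := (1 + 24 * u) ^ d) (y := 5 * (d * ℓ))
    (one_le_pow₀ (by linarith))
    (by
      have h1 : Real.log (1 + 24 * u) ≤ 5 * ℓ := by
        have := Real.log_le_log (x := 1 + 24 * u) (y := (2 * u) ^ 5) (by linarith)
          (by rw [mul_pow]; linarith)
        rw [hpow] at this
        exact_mod_cast this
      rw [Real.log_pow]
      nlinarith)
    (by linarith)
  obtain ⟨bf, hbf, hbfle⟩ := exists_bits (x := 51 * u) (y := 6 * (d * ℓ)) (by linarith)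
    (by
      have := Real.log_le_log (x := 51 * u) (y := (2 * u) ^ 6) (by linarith)
        (by rw [mul_pow]; linarith)
      rw [hpow] at this
      push_cast at this
      linarith)
    (by linarith)
  obtain ⟨qg, hqg⟩ := exists_vectorQuantizer (d := d) (R := L) (δ := ε / (12 * B)) (b := bv)
    hL'.le (by positivity) (by
      refine le_trans (le_of_eq ?_) hbv
      rw [hu]; congr 2; field_simp; ring)
  -- The output and the values are rounded more finely than demanded, so that the errors `ε/4 + ε/6
  -- + 2 * (ε/12) + ε/6` stay below `ε`.
  obtain ⟨qo, hqo⟩ := exists_vectorQuantizer (d := d) (R := B) (δ := ε / (6 * L)) (b := bv)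
    hB.le (by positivity) (by
      refine le_trans (pow_le_pow_left₀ (by positivity) ?_ d) hbv
      have : 2 * B / (ε / (6 * L)) = 12 * u := by rw [hu]; field_simp; ring
      linarith)
  obtain ⟨qf, hqf⟩ := exists_valueQuantizer (R := 2 * L * B) (δ := ε / 12) (by positivity) T
    (b := bf) (by
      refine lt_of_lt_of_le ?_ hbf
      have : 2 * L * B / (ε / 12) = 24 * u := by rw [hu]; field_simp; ring
      linarith)
  refine ⟨T, bv, bf, bv, qg, qf, qo, hqg, hqf.mono (by linarith), hqo.mono ?_, ?_, ?_, ?_⟩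
  · gcongr
    norm_num
  · nlinarith
  · push_cast
    -- The total is at most `14 * 44 * (d * ℓ) ^ 2` plus `20 * (d * ℓ) ≤ 40 * (d * ℓ) ^ 2` for the
    -- output.
    have h1 : (T : ℝ) * (bv + bf) ≤ 14 * (d * ℓ) * (20 * (d * ℓ) + 24 * (d * ℓ)) :=
      mul_le_mul hTle (by linarith) (by positivity) (by positivity)
    have h2 : (d : ℝ) * ℓ ≤ 2 * (d * ℓ) ^ 2 := by nlinarith
    have h3 : 1000 * (d : ℝ) ^ 2 * ℓ ^ 2 = 1000 * (d * ℓ) ^ 2 := by ring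
    rw [h3]
    nlinarith
  · intro F xs g _ hF _ hxs hg
    refine (output_comAlgorithm_sub_le hB (θ := 1 / (8 * u)) (by positivity)
      (by rw [div_le_one (by positivity)]; linarith) hT hqg hqf hqo hF hxs hg).trans ?_
    have h1 : L * (2 * (1 / (8 * u)) * B) = ε / 4 := by rw [hu]; field_simp; ring
    have h2 : ε / (12 * B) * (2 * B) = ε / 6 := by field_simp; ring
    have h3 : L * (ε / (6 * L)) = ε / 6 := by field_simp
    linarith
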